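/- **Setting.** An instance consists of finitely many jobs and $m$ unrelated machines. Job $j$ has a release date $r_j$, a deadline $d_j$, a weight $w_j>0$ and, on machine $i$, a processing time $p_{ij}\in\mathbb{R}_{>0}\cup\{\infty\}$; machine $i$ is eligible for $j$ if $p_{ij}<\infty$. For a slack parameter $\varepsilon>0$ it is assumed that $d_j-r_j\ge(1+\varepsilon)p_{ij}$ whenever $i$ is eligible for $j$. The density of $j$ on $i$ is $\rho_{ij}=w_j/p_{ij}$. **Two-threshold algorithm.** If $\varepsilon>1$, reset $\varepsilon\leftarrow 1$. Each job is admitted at most once, to one machine; let $a_j$ be the admission time of $j$. A job $j$ is *active* on machine $i$ at time $\tau$ if it was admitted to $i$ before $\tau$, is not yet completed, and its remaining processing time on $i$ is at most $a_j+(1+\frac{\varepsilon}{2})p_{ij}-\tau$. *Scheduling routine.* At all times every machine $i$ processes a job with highest density $\rho_{ij}$ among the jobs that are active on $i$, where a job that has just been admitted to $i$ is included; it idles if there is none. The processing takes place in half-open time intervals $[s,t)$. *Admission routine.* It is called at time $\tau$ whenever a job is released or completed. For $i=1,\dots,m$ it considers the jobs $j^\star$ that are released ($r_{j^\star}\le\tau$),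 not yet admitted, and satisfy $p_{ij^\star}<\infty$ and $d_{j^\star}-\tau\ge(1+\frac{\varepsilon}{2})p_{ij^\star}$, in decreasing order of $\rho_{ij^\star}$ (ties are broken arbitrarily). If no job is currently running on $i$, then $j^\star$ is admitted to $i$ at time $\tau$. If job $j$ is currently running on $i$, then $j^\star$ is admitted to $i$ at time $\tau$ if and only if one of the following holds: * $p_{ij^\star}\le\frac{\varepsilon}{2}p_{ij}$ and $\rho_{ij^\star}\ge\frac{8}{\varepsilon}\rho_{ij}$; * $\frac{\varepsilon}{2}p_{ij}<p_{ij^\star}\le p_{ij}$ and $w_{j^\star}\ge 4w_j$; * $p_{ij^\star}>p_{ij}$ and $\rho_{ij^\star}\ge 4\rho_{ij}$. An admitted job becomes the running job of machine $i$. **Theorem.** For every such instance and every execution of the two-threshold algorithm on it, let $J$ be the set of jobs admitted by the algorithm and let $F\subseteq J$ be the set of admitted jobs that the algorithm completes by their deadlines. Then $$\sum_{j\in F}w_j\;\ge\;\frac12\sum_{j\in J}w_j .$$ -/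

import Mathlib

open scoped ENNReal

/-- An instance of weighted throughput maximization on `m` unrelated machines with slack `ε`.
`p i j = ⊤` means that machine `i` is not eligible for job `j`. -/
structure ThroughputInstance (m : ℕ) (J : Type*) (ε : ℝ) where
  /-- release date -/
  r : J → ℝ
  /-- deadline -/
  d : J → ℝ
  /-- weight -/
  w : J → ℝ
  /-- processing time of a job on a machine -/
  p : Fin m → J → ℝ≥0∞
  w_pos : ∀ j, 0 < w j
  p_pos : ∀ i j, p i j ≠ 0
  slack : ∀ i j, p i j ≠ ⊤ → (1 + ε) * (p i j).toReal ≤ d j - r j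

namespace ThroughputInstance

variable {m : ℕ} {J : Type*} {ε : ℝ} (I : ThroughputInstance m J ε)

/-- The processing time as a real number (only meaningful on eligible machines). -/
noncomputable def size (i : Fin m) (j : J) : ℝ := (I.p i j).toReal

/-- The density `w_j / p_ij` (it is `0` if `i` is not eligible for `j`). -/
noncomputable def density (i : Fin m) (j : J) : ℝ := I.w j / I.size i j

/-- The slack parameter with which the algorithm works: a value above `1` is reset to `1`. -/
noncomputable def slackParam (_I : ThroughputInstance m J ε) : ℝ := min ε 1

/-- The test that the new job `k` has to pass on machine `i` to interrupt the running job `j`. -/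
def Interrupts (i : Fin m) (j k : J) : Prop :=
  (I.size i k ≤ I.slackParam / 2 * I.size i j ∧
      8 / I.slackParam * I.density i j ≤ I.density i k) ∨
  (I.slackParam / 2 * I.size i j < I.size i k ∧ I.size i k ≤ I.size i j ∧
      4 * I.w j ≤ I.w k) ∨
  (I.size i j < I.size i k ∧ 4 * I.density i j ≤ I.density i k)

/-- The test of job `k` against the content of machine `i`: a job is always admitted to a machine
that has no active job. -/
def Passes (i : Fin m) : Option J → J → Prop
  | none, _ => True
  | some j, k => I.Interrupts i j k

open Classical in
/-- One pass of the admission routine on machine `i`. The candidates are considered in the order of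
the given list, each is compared with the job that is running at that moment, and an admitted job
becomes the running job. The result is the list of the admitted jobs. -/
noncomputable def admitLoop (i : Fin m) : Option J → List J → List J
  | _, [] => []
  | cur, k :: ks =>
      if I.Passes i cur k then k :: admitLoop i (some k) ks else admitLoop i cur ks

/-- `I.IsDensest i S o`: the option `o` is a job of highest density on machine `i` in the set `S`,
and is `none` if `S` is empty. -/
def IsDensest (i : Fin m) (S : Set J) : Option J → Prop
  | none => S = ∅
  | some j => j ∈ S ∧ ∀ k ∈ S, I.density i k ≤ I.density i j

end ThroughputInstance

/-- A non-migratory online schedule together with its admission decisions. Every job is admitted at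
most once, to one machine at one time; at every time every machine processes at most one job, and it
does so in intervals of the form `[s, t)`. -/
structure OnlineSchedule (m : ℕ) (J : Type*) where
  /-- `adm j = some (i, a)`: job `j` is admitted to machine `i` at time `a`;
  `adm j = none`: job `j` is never admitted. -/
  adm : J → Option (Fin m × ℝ)
  /-- the job (if any) that a machine processes at a given time -/
  proc : Fin m → ℝ → Option J
  proc_right : ∀ i τ, ∃ δ > 0, ∀ s ∈ Set.Ico τ (τ + δ), proc i s = proc i τ
  proc_meas : ∀ i j, MeasurableSet {s | proc i s = some j}

namespace OnlineSchedule

variable {m : ℕ} {J : Type*} {ε : ℝ} (S : OnlineSchedule m J) (I : ThroughputInstance m J ε)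

/-- The amount of time that machine `i` has spent on job `j` before time `τ`. -/
noncomputable def processed (i : Fin m) (j : J) (τ : ℝ) : ℝ :=
  MeasureTheory.volume.real {s | s < τ ∧ S.proc i s = some j}

/-- The remaining processing time of `j` on machine `i` at time `τ`. -/
noncomputable def remaining (i : Fin m) (j : J) (τ : ℝ) : ℝ := I.size i j - S.processed i j τ

/-- The jobs that are active on machine `i` at time `τ`: they were admitted to `i` before `τ` at
some time `a`, are not completed, and can still be completed by `a + (1 + ε/2) p_ij`. -/
def active (i : Fin m) (τ : ℝ) : Set J :=
  {j | ∃ a, S.adm j = some (i, a) ∧ a < τ ∧ 0 < S.remaining I i j τ ∧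
    S.remaining I i j τ ≤ a + (1 + I.slackParam / 2) * I.size i j - τ}

/-- Job `j` is completed at time `τ` (on the machine to which it was admitted). -/
def CompletesAt (j : J) (τ : ℝ) : Prop :=
  ∃ i a, S.adm j = some (i, a) ∧ S.processed i j τ = I.size i j ∧
    ∀ s < τ, S.processed i j s < I.size i j

/-- The times at which the admission routine is called: a job is released or completed. -/
def IsEvent (τ : ℝ) : Prop := (∃ j, I.r j = τ) ∨ ∃ j, S.CompletesAt I j τ

/-- The jobs that the admission routine, called at time `τ`, considers for machine `i`: released,
not yet admitted (before `τ`, or at `τ` to an earlier machine of the loop), and with a deadline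
sufficiently far in the future. -/
def candidates (i : Fin m) (τ : ℝ) : Set J :=
  {k | I.r k ≤ τ ∧ I.p i k ≠ ⊤ ∧ (1 + I.slackParam / 2) * I.size i k ≤ I.d k - τ ∧
    ¬ ∃ i' a, S.adm k = some (i', a) ∧ (a < τ ∨ (a = τ ∧ i' < i))}

/-- `S` is an execution of the two-threshold algorithm on the instance `I`. Ties between jobs of
equal density may be broken in any way. -/
structure IsTwoThreshold : Prop where
  /-- Scheduling routine: at all times, every machine runs a job of highest density among the
  active jobs, where a job that is admitted right now is included. -/
  scheduling : ∀ i τ,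
    I.IsDensest i (S.active I i τ ∪ {j | S.adm j = some (i, τ)}) (S.proc i τ)
  /-- Jobs are admitted only by the admission routine, which is called only at events. -/
  admission_event : ∀ i τ k, S.adm k = some (i, τ) → S.IsEvent I τ
  /-- Admission routine: at an event, on every machine, the candidates are considered in decreasing
  order of density, starting from the currently running job. -/
  admission : ∀ i τ, S.IsEvent I τ →
    ∃ (cur : Option J) (L : List J),
      I.IsDensest i (S.active I i τ) cur ∧
      L.Nodup ∧ (∀ k, k ∈ L ↔ k ∈ S.candidates I i τ) ∧
      L.Pairwise (fun k l => I.density i l ≤ I.density i k) ∧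
      ∀ k, S.adm k = some (i, τ) ↔ k ∈ I.admitLoop i cur L

open Classical in
/-- The set of admitted jobs. -/
noncomputable def admittedJobs [Fintype J] : Finset J :=
  Finset.univ.filter fun j => ∃ i a, S.adm j = some (i, a)

open Classical in
/-- The set of admitted jobs that are completed by their deadlines. -/
noncomputable def finishedJobs [Fintype J] : Finset J :=
  Finset.univ.filter fun j => ∃ τ ≤ I.d j, S.CompletesAt I j τ

end OnlineSchedule

/-! Make each admitted job a child of the job that it interrupts, that is, of a densest job active
on its machine when it is admitted. Write δ for `slackParam / 2`. Each child is at least four times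
as dense as its parent, and it is also either four times as heavy or 4/δ times as dense
(`Interrupts.mul_size_le_or`).

If a job j misses its deadline, then it waits for at least δ·p_j while still active. All this time
its machine processes descendants of j, so their total size is at least δ·p_j
(`mul_size_le_sum_descendants`).

Now count finished jobs with weight w and unfinished ones with weight -w. Induction from the leaves
shows that every subtree has signed weight at least the weight of its root
(`sum_le_two_mul_sum_of_forest`). Summing over the roots, the unfinished weight is at most the
finished weight. -/

/-! ### Weight accounting in forests. -/

section Forest

variable {J : Type*}

open Classical in
/-- Sums over the subtrees of a well-founded forest, given by their recursion. -/
theorem exists_treeSum [Fintype J] {par : J → Option J} (wf : WellFounded fun k j => par k = some j)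
    (f : J → ℝ) :
    ∃ T : J → ℝ, ∀ j, T j = f j + ∑ k with par k = some j, T k := by
  refine ⟨wf.fix fun j ih => f j + ∑ k, if h : par k = some j then ih k h else 0, fun j => ?_⟩
  rw [wf.fix_eq, Finset.sum_filter]
  simp

-- Summing the recursion over all vertices, each non-root value of `T` occurs once on either side
-- and cancels.
open Classical in
theorem sum_eq_sum_roots [Fintype J] {par : J → Option J} {f T : J → ℝ}
    (hT : ∀ j, T j = f j + ∑ k with par k = some j, T k) :
    ∑ j, f j = ∑ j with par j = none, T j := by
  have h1 : ∑ j, ∑ k with par k = some j, T k = ∑ k with par k ≠ none, T k := by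
    simp_rw [Finset.sum_filter]
    rw [Finset.sum_comm]
    refine Finset.sum_congr rfl fun k _ => ?_
    cases h : par k <;> simp
  have h2 : ∑ j, T j = ∑ j, f j + ∑ k with par k ≠ none, T k := by
    rw [← h1, ← Finset.sum_add_distrib]
    exact Finset.sum_congr rfl fun j _ => hT j
  have h3 := Finset.sum_filter_add_sum_filter_not Finset.univ (fun j => par j = none) T
  simp only [ne_eq] at h2
  linarith

open Classical in
theorem sum_biUnion_le_sum_sum {ι : Type*} (s : Finset ι) (t : ι → Finset J) {f : J → ℝ}
    (hf : ∀ j, 0 ≤ f j) : ∑ x ∈ s.biUnion t, f x ≤ ∑ k ∈ s, ∑ x ∈ t k, f x := by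
  induction s using Finset.induction_on with
  | empty => simp
  | insert a s ha ih =>
    rw [Finset.biUnion_insert, Finset.sum_insert ha]
    have h1 := Finset.sum_union_inter (s₁ := t a) (s₂ := s.biUnion t) (f := f)
    have h2 : 0 ≤ ∑ x ∈ t a ∩ s.biUnion t, f x := Finset.sum_nonneg fun x _ => hf x
    linarith

-- A descendant is a child or a descendant of a child. Only a union bound is used, so subtrees need
-- not be shown disjoint.
open Classical in
theorem sum_descendants_le [Fintype J] {par : J → Option J} (wf : WellFounded fun k j => par k = some j)
    {f T : J → ℝ} (hf : ∀ j, 0 ≤ f j)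
    (hT : ∀ j, T j = f j + ∑ k with par k = some j, T k) (j : J) :
    ∑ k with Relation.TransGen (fun k j => par k = some j) k j, f k
      ≤ ∑ k with par k = some j, T k := by
  induction j using wf.induction with
  | _ j ih =>
    have hsub : (Finset.univ.filter fun k => Relation.TransGen (fun k j => par k = some j) k j) ⊆
        (Finset.univ.filter fun k => par k = some j).biUnion fun k =>
          insert k (Finset.univ.filter fun l =>
            Relation.TransGen (fun k j => par k = some j) l k) := by
      intro l hl
      simp only [Finset.mem_filter, Finset.mem_univ, true_and, Finset.mem_biUnion,
        Finset.mem_insert] at hl ⊢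
      rcases Relation.TransGen.tail'_iff.1 hl with ⟨b, hlb, hb⟩
      refine ⟨b, hb, ?_⟩
      rcases Relation.reflTransGen_iff_eq_or_transGen.1 hlb with h | h
      · exact Or.inl h.symm
      · exact Or.inr h
    refine (Finset.sum_le_sum_of_subset_of_nonneg hsub fun _ _ _ => hf _).trans ?_
    refine (sum_biUnion_le_sum_sum _ _ hf).trans ?_
    refine Finset.sum_le_sum fun k hk => ?_
    simp only [Finset.mem_filter, Finset.mem_univ, true_and] at hk
    have hle : ∑ l ∈ insert k (Finset.univ.filter fun l =>
        Relation.TransGen (fun k j => par k = some j) l k), f l ≤ f k +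
        ∑ l with Relation.TransGen (fun k j => par k = some j) l k, f l := by
      by_cases h : k ∈ Finset.univ.filter fun l =>
          Relation.TransGen (fun k j => par k = some j) l k
      · rw [Finset.insert_eq_of_mem h]
        linarith [hf k]
      · rw [Finset.sum_insert h]
    rw [hT k]
    linarith [ih k hk]

open Classical in
/-- In a forest in which every child is heavy compared to its parent, and every vertex outside `F`
has large total descendant size, the vertices in `F` carry at least half of the weight. -/
theorem sum_le_two_mul_sum_of_forest [Fintype J] {par : J → Option J}
    (wf : WellFounded fun k j => par k = some j) {w p : J → ℝ} {δ : ℝ} (F : J → Prop)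
    [DecidablePred F] (hδ : 0 < δ) (hw : ∀ j, 0 ≤ w j) (hp : ∀ j, 0 < p j)
    (hdens : ∀ k j, par k = some j → 4 * w j * p k ≤ w k * p j)
    (hcase : ∀ k j, par k = some j → 4 * w j * p k ≤ δ * (w k * p j) ∨ 4 * w j ≤ w k)
    (hF : ∀ j, ¬ F j →
      δ * p j ≤ ∑ k with Relation.TransGen (fun k j => par k = some j) k j, p k) :
    ∑ j, w j ≤ 2 * ∑ j with F j, w j := by
  obtain ⟨W, hW⟩ := exists_treeSum wf fun j => if F j then w j else - w j
  obtain ⟨y, hy⟩ := exists_treeSum wf p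
  have y_nonneg : ∀ j, 0 ≤ y j := fun j => by
    induction j using wf.induction with
    | _ j ih =>
      rw [hy]
      exact add_nonneg (hp j).le (Finset.sum_nonneg fun k hk => ih k (by simpa using hk))
  -- The second invariant says that signed weight per unit of subtree size is at least half the
  -- density of the root. It converts total descendant size into weight.
  have key : ∀ j, w j ≤ W j ∧ w j * y j ≤ 2 * (p j * W j) := fun j => by
    induction j using wf.induction with
    | _ j ih =>
      have hY : 0 ≤ ∑ k with par k = some j, y k := Finset.sum_nonneg fun k _ => y_nonneg k
      have hS0 : 0 ≤ ∑ k with par k = some j, W k := Finset.sum_nonneg fun k hk =>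
        (hw k).trans (ih k (by simpa using hk)).1
      have hchild : ∀ c, 0 ≤ c → ∀ k, par k = some j → 4 * w j * p k ≤ c * (w k * p j) →
          2 * w j * y k ≤ c * p j * W k := by
        intro c hc k hk hck
        have h1 := mul_le_mul_of_nonneg_right hck (y_nonneg k)
        have h2 := mul_le_mul_of_nonneg_left (ih k hk).2 (mul_nonneg hc (hp j).le)
        have h3 : p k * (4 * w j * y k) ≤ p k * (2 * (c * p j * W k)) := by linarith
        have h4 := le_of_mul_le_mul_left h3 (hp k)
        linarith
      have hsum : ∀ c, 0 ≤ c → (∀ k, par k = some j → 4 * w j * p k ≤ c * (w k * p j)) →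
          2 * w j * (∑ k with par k = some j, y k)
            ≤ c * p j * ∑ k with par k = some j, W k := by
        intro c hc hck
        rw [Finset.mul_sum, Finset.mul_sum]
        refine Finset.sum_le_sum fun k hk => ?_
        have hk' : par k = some j := by simpa using hk
        exact hchild c hc k hk' (hck k hk')
      have hone := hsum 1 zero_le_one fun k hk => by rw [one_mul]; exact hdens k j hk
      rw [hy j, hW j]
      have hwY := mul_nonneg (hw j) hY
      have hwp := mul_nonneg (hw j) (hp j).le
      have hjw := hw j
      have hpj := hp j
      generalize hYd : ∑ k with par k = some j, y k = Y at *
      generalize hSd : ∑ k with par k = some j, W k = S at *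
      by_cases hFj : F j
      · simp only [hFj, if_true]
        constructor
        · linarith
        · nlinarith
      -- Given `hone`, both invariants for an unfinished vertex follow from `2 * w j ≤ S`.
      · simp only [hFj, if_false]
        by_cases hbig : ∃ k, par k = some j ∧ 4 * w j ≤ w k
        · obtain ⟨k, hk, hwk⟩ := hbig
          have hkS : W k ≤ S := by
            rw [← hSd]
            exact Finset.single_le_sum (f := W)
              (fun l hl => (hw l).trans (ih l (by simpa using hl)).1) (by simpa using hk)
          have h4 : 4 * w j ≤ S := by linarith [(ih k hk).1]
          have h5 := mul_le_mul_of_nonneg_left h4 hpj.le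
          constructor <;> linarith
        -- Every child is 4/δ times as dense, so `2 * w j * Y ≤ δ * p j * S`. Since `Y` is at least
        -- `δ * p j`, this factor cancels.
        · push Not at hbig
          have hδs := hsum δ hδ.le fun k hk => (hcase k j hk).resolve_right
            (not_le.2 (hbig k hk))
          have hlow : δ * p j ≤ Y := by
            rw [← hYd]
            exact (hF j hFj).trans (sum_descendants_le wf (fun j => (hp j).le) hy j)
          have h6 : δ * p j * (2 * w j) ≤ δ * p j * S := by
            have := mul_le_mul_of_nonneg_left hlow hjw
            linarith
          have h7 := le_of_mul_le_mul_left h6 (mul_pos hδ hpj)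
          have h8 := mul_le_mul_of_nonneg_left h7 hpj.le
          constructor <;> linarith
  have hroots : 0 ≤ ∑ j, (if F j then w j else - w j) := by
    rw [sum_eq_sum_roots hW]
    exact Finset.sum_nonneg fun j _ => (hw j).trans (key j).1
  rw [Finset.sum_ite, Finset.sum_neg_distrib] at hroots
  have := Finset.sum_filter_add_sum_filter_not Finset.univ F w
  linarith

end Forest

/-! ### The interruption test and the admission loop. -/

namespace ThroughputInstance

variable {m : ℕ} {J : Type*} {ε : ℝ} (I : ThroughputInstance m J ε)

theorem slackParam_pos (hε : 0 < ε) : 0 < I.slackParam := lt_min hε one_pos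

theorem slackParam_le_one : I.slackParam ≤ 1 := min_le_right _ _

theorem size_nonneg (i : Fin m) (j : J) : 0 ≤ I.size i j := ENNReal.toReal_nonneg

theorem size_pos {i : Fin m} {j : J} (h : I.p i j ≠ ⊤) : 0 < I.size i j :=
  ENNReal.toReal_pos (I.p_pos i j) h

theorem density_nonneg (i : Fin m) (j : J) : 0 ≤ I.density i j :=
  div_nonneg (I.w_pos j).le (I.size_nonneg i j)

theorem density_pos {i : Fin m} {j : J} (h : I.p i j ≠ ⊤) : 0 < I.density i j :=
  div_pos (I.w_pos j) (I.size_pos h)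

variable {I}

/-- For short jobs `slackParam ≤ 1` makes the factor 8/ε at least 4; for medium ones the weight
quadruples while the size does not grow. -/
theorem Interrupts.four_mul_density_le (hε : 0 < ε) {i : Fin m} {j k : J}
    (hk : 0 < I.size i k) (h : I.Interrupts i j k) : 4 * I.density i j ≤ I.density i k := by
  rcases h with ⟨-, h⟩ | ⟨-, h1, h2⟩ | ⟨-, h⟩
  · refine le_trans (mul_le_mul_of_nonneg_right ?_ (I.density_nonneg i j)) h
    rw [le_div_iff₀ (I.slackParam_pos hε)]
    linarith [I.slackParam_le_one]
  · have hj : 0 < I.size i j := hk.trans_le h1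
    rw [density, density, ← mul_div_assoc]
    exact div_le_div₀ (I.w_pos k).le h2 hk h1
  · exact h

theorem Interrupts.mul_size_le_or (hε : 0 < ε) {i : Fin m} {j k : J}
    (hj : 0 < I.size i j) (hk : 0 < I.size i k) (h : I.Interrupts i j k) :
    4 * I.w j * I.size i k ≤ I.slackParam / 2 * (I.w k * I.size i j) ∨ 4 * I.w j ≤ I.w k := by
  have hs := I.slackParam_pos hε
  rcases h with ⟨-, h⟩ | ⟨-, -, h⟩ | ⟨h1, h2⟩
  · left
    rw [density, density, div_mul_div_comm, div_le_div_iff₀ (mul_pos hs hj) hk] at h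
    linarith
  · exact Or.inr h
  -- A longer job that is four times as dense is also four times as heavy.
  · right
    rw [density, density, ← mul_div_assoc, div_le_div_iff₀ hj hk] at h2
    have h3 : 4 * I.w j * I.size i j ≤ I.w k * I.size i j :=
      le_trans (mul_le_mul_of_nonneg_left h1.le (by linarith [I.w_pos j])) h2
    exact le_of_mul_le_mul_right h3 hj

/-- Passing requires four times the positive density of the running job. As candidates come in
decreasing density, one admission blocks all later ones. -/
theorem admitLoop_eq_nil (hε : 0 < ε) {i : Fin m} {j : J} {L : List J}
    (hL : ∀ k ∈ L, I.p i k ≠ ⊤ ∧ I.density i k ≤ I.density i j) :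
    I.admitLoop i (some j) L = [] := by
  induction L with
  | nil => rfl
  | cons k ks ih =>
    have hk := hL k List.mem_cons_self
    have hnot : ¬ I.Passes i (some j) k := fun h => by
      have h4 := Interrupts.four_mul_density_le hε (I.size_pos hk.1) h
      linarith [I.density_pos hk.1]
    rw [admitLoop, if_neg hnot]
    exact ih fun l hl => hL l (List.mem_cons_of_mem _ hl)

/-- A pass of the admission routine admits at most one job, and it passes the test against the
job that was running initially. -/
theorem admitLoop_mem (hε : 0 < ε) {i : Fin m} {cur : Option J} {L : List J}
    (hp : ∀ k ∈ L, I.p i k ≠ ⊤)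
    (hL : L.Pairwise fun k l => I.density i l ≤ I.density i k) {k : J}
    (hk : k ∈ I.admitLoop i cur L) :
    k ∈ L ∧ I.Passes i cur k ∧ ∀ l ∈ I.admitLoop i cur L, l = k := by
  induction L with
  | nil => simp [admitLoop] at hk
  | cons b ks ih =>
    rw [List.pairwise_cons] at hL
    have hp' : ∀ l ∈ ks, I.p i l ≠ ⊤ := fun l hl => hp l (List.mem_cons_of_mem _ hl)
    by_cases hb : I.Passes i cur b
    · have hnil := admitLoop_eq_nil hε fun l hl => ⟨hp' l hl, hL.1 l hl⟩
      rw [admitLoop, if_pos hb, hnil, List.mem_singleton] at hk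
      subst hk
      rw [admitLoop, if_pos hb, hnil]
      exact ⟨List.mem_cons_self, hb, fun l hl => List.mem_singleton.1 hl⟩
    · rw [admitLoop, if_neg hb] at hk ⊢
      obtain ⟨h1, h2, h3⟩ := ih hp' hL.2 hk
      exact ⟨List.mem_cons_of_mem _ h1, h2, h3⟩

end ThroughputInstance

/-! ### Admissions in an execution. -/

namespace OnlineSchedule

variable {m : ℕ} {J : Type*} {ε : ℝ} {S : OnlineSchedule m J} {I : ThroughputInstance m J ε}

theorem adm_eq_of_mem_active {i i' : Fin m} {j : J} {a τ : ℝ} (h : j ∈ S.active I i τ)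
    (ha : S.adm j = some (i', a)) : i' = i ∧ a < τ := by
  obtain ⟨b, hb, hlt, -⟩ := h
  rw [ha] at hb
  simp only [Option.some.injEq, Prod.mk.injEq] at hb
  exact ⟨hb.1, hb.2 ▸ hlt⟩

/-- The admission time of an admitted job, and `0` for other jobs. -/
def admTime (S : OnlineSchedule m J) (j : J) : ℝ := (S.adm j).elim 0 Prod.snd

theorem admTime_eq {i : Fin m} {j : J} {a : ℝ} (h : S.adm j = some (i, a)) :
    S.admTime j = a := by
  simp [admTime, h]

namespace IsTwoThreshold

open MeasureTheory

section Admission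

variable {i : Fin m} {j k : J} {a τ σ : ℝ}

theorem mem_candidates_of_adm (hS : S.IsTwoThreshold I) (hε : 0 < ε)
    (ha : S.adm j = some (i, a)) : j ∈ S.candidates I i a := by
  obtain ⟨cur, L, -, -, hmem, hsort, hadm⟩ := hS.admission i a (hS.admission_event i a j ha)
  have hp : ∀ k ∈ L, I.p i k ≠ ⊤ := fun k hk => ((hmem k).1 hk).2.1
  exact (hmem j).1 (ThroughputInstance.admitLoop_mem hε hp hsort ((hadm j).1 ha)).1

theorem size_pos_of_adm (hS : S.IsTwoThreshold I) (hε : 0 < ε)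
    (ha : S.adm j = some (i, a)) : 0 < I.size i j :=
  I.size_pos (hS.mem_candidates_of_adm hε ha).2.1

theorem add_mul_size_le_deadline (hS : S.IsTwoThreshold I) (hε : 0 < ε)
    (ha : S.adm j = some (i, a)) : a + (1 + I.slackParam / 2) * I.size i j ≤ I.d j := by
  linarith [(hS.mem_candidates_of_adm hε ha).2.2.1]

theorem adm_injective (hS : S.IsTwoThreshold I) (hε : 0 < ε)
    (hj : S.adm j = some (i, a)) (hk : S.adm k = some (i, a)) : j = k := by
  obtain ⟨cur, L, -, -, hmem, hsort, hadm⟩ := hS.admission i a (hS.admission_event i a j hj)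
  have hp : ∀ k ∈ L, I.p i k ≠ ⊤ := fun k hk => ((hmem k).1 hk).2.1
  exact (ThroughputInstance.admitLoop_mem hε hp hsort ((hadm k).1 hk)).2.2 j ((hadm j).1 hj)

theorem exists_passes (hS : S.IsTwoThreshold I) (hε : 0 < ε) (hj : S.adm j = some (i, a)) :
    ∃ cur, I.IsDensest i (S.active I i a) cur ∧ I.Passes i cur j := by
  obtain ⟨cur, L, hcur, -, hmem, hsort, hadm⟩ := hS.admission i a (hS.admission_event i a j hj)
  have hp : ∀ k ∈ L, I.p i k ≠ ⊤ := fun k hk => ((hmem k).1 hk).2.1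
  exact ⟨cur, hcur, (ThroughputInstance.admitLoop_mem hε hp hsort ((hadm j).1 hj)).2.1⟩

theorem mem_of_proc (hS : S.IsTwoThreshold I) (h : S.proc i τ = some j) :
    j ∈ S.active I i τ ∪ {j | S.adm j = some (i, τ)} := by
  have := hS.scheduling i τ
  rw [h] at this
  exact this.1

theorem le_of_proc (hS : S.IsTwoThreshold I) (ha : S.adm j = some (i, a))
    (h : S.proc i τ = some j) : a ≤ τ := by
  rcases hS.mem_of_proc h with h | h
  · exact (adm_eq_of_mem_active h ha).2.le
  · simp only [Set.mem_ofPred_eq] at h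
    rw [ha] at h
    simp only [Option.some.injEq, Prod.mk.injEq, true_and] at h
    exact h.le

end Admission

/-! ### Processed time as a function of time. -/

section Processing

variable {i : Fin m} {j k : J} {a τ σ : ℝ}

/-- `volume.real` is 0 on sets of infinite measure, so monotonicity needs finiteness. It holds
because no job is processed before its admission. -/
theorem volume_proc_ne_top (hS : S.IsTwoThreshold I) (ha : S.adm j = some (i, a)) (τ : ℝ) :
    volume {s | s < τ ∧ S.proc i s = some j} ≠ ⊤ := by
  have hsub : {s | s < τ ∧ S.proc i s = some j} ⊆ Set.Ico a τ := fun s hs =>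
    ⟨hS.le_of_proc ha hs.2, hs.1⟩
  exact measure_ne_top_of_subset hsub measure_Ico_lt_top.ne

theorem processed_mono (hS : S.IsTwoThreshold I) (ha : S.adm j = some (i, a)) :
    Monotone (S.processed i j) := fun _ τ h =>
  measureReal_mono (fun _ hs => ⟨hs.1.trans_le h, hs.2⟩) (hS.volume_proc_ne_top ha τ)

theorem processed_eq_zero (hS : S.IsTwoThreshold I) (ha : S.adm j = some (i, a)) (h : τ ≤ a) :
    S.processed i j τ = 0 := by
  have : {s | s < τ ∧ S.proc i s = some j} = ∅ := by
    ext s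
    simp only [Set.mem_ofPred_eq, Set.mem_empty_iff_false, iff_false, not_and]
    intro hs hp
    linarith [hS.le_of_proc ha hp]
  rw [processed, this, measureReal_empty]

theorem processed_le_add (hS : S.IsTwoThreshold I) (ha : S.adm j = some (i, a)) (h : σ ≤ τ) :
    S.processed i j τ ≤ S.processed i j σ + (τ - σ) := by
  have hsub : {s | s < τ ∧ S.proc i s = some j} ⊆
      {s | s < σ ∧ S.proc i s = some j} ∪ Set.Ico σ τ := by
    intro s hs
    rcases lt_or_ge s σ with h' | h'
    · exact Or.inl ⟨h', hs.2⟩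
    · exact Or.inr ⟨h', hs.1⟩
  have hfin : volume ({s | s < σ ∧ S.proc i s = some j} ∪ Set.Ico σ τ) ≠ ⊤ :=
    measure_union_ne_top (hS.volume_proc_ne_top ha σ) measure_Ico_lt_top.ne
  refine (measureReal_mono hsub hfin).trans ((measureReal_union_le _ _).trans ?_)
  rw [Real.volume_real_Ico_of_le h, processed]

theorem continuous_processed (hS : S.IsTwoThreshold I) (ha : S.adm j = some (i, a)) :
    Continuous (S.processed i j) := by
  refine LipschitzWith.continuous (K := 1) (LipschitzWith.of_le_add fun x y => ?_)
  rcases le_total x y with h | h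
  · linarith [hS.processed_mono ha h, dist_nonneg (x := x) (y := y)]
  · rw [Real.dist_eq, abs_of_nonneg (sub_nonneg.2 h)]
    exact hS.processed_le_add ha h

/-- Once the processed time reaches the size, the job is no longer active and is never processed
again. -/
theorem processed_le_size (hS : S.IsTwoThreshold I) (hε : 0 < ε)
    (ha : S.adm j = some (i, a)) (τ : ℝ) : S.processed i j τ ≤ I.size i j := by
  by_contra! hlt
  have hpos := hS.size_pos_of_adm hε ha
  have haτ : a ≤ τ := by
    by_contra! h
    rw [hS.processed_eq_zero ha h.le] at hlt
    linarith
  have hmem : I.size i j ∈ Set.Icc (S.processed i j a) (S.processed i j τ) := by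
    rw [hS.processed_eq_zero ha le_rfl]
    exact ⟨hpos.le, hlt.le⟩
  obtain ⟨σ, ⟨haσ, -⟩, hσ⟩ :=
    intermediate_value_Icc haτ (hS.continuous_processed ha).continuousOn hmem
  have hsub : {s | s < τ ∧ S.proc i s = some j} ⊆ {s | s < σ ∧ S.proc i s = some j} := by
    rintro s ⟨-, hs⟩
    refine ⟨?_, hs⟩
    by_contra! hσs
    have hge := hS.processed_mono ha hσs
    rcases hS.mem_of_proc hs with ⟨_, -, -, hrem, -⟩ | h
    · rw [remaining] at hrem
      linarith
    · have := hS.processed_eq_zero h le_rfl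
      linarith
  have : S.processed i j τ ≤ S.processed i j σ :=
    measureReal_mono hsub (hS.volume_proc_ne_top ha σ)
  linarith

/-- Going back in time, the remaining time grows no faster than the bound it has to satisfy. -/
theorem mem_active_of_le (hS : S.IsTwoThreshold I) (ha : S.adm j = some (i, a))
    (h : j ∈ S.active I i τ) (haσ : a < σ) (hστ : σ ≤ τ) : j ∈ S.active I i σ := by
  obtain ⟨b, hb, -, hrem, hle⟩ := h
  rw [ha] at hb
  simp only [Option.some.injEq, Prod.mk.injEq, true_and] at hb
  subst hb
  have h1 := hS.processed_mono ha hστ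
  have h2 := hS.processed_le_add ha hστ
  rw [remaining] at hrem hle
  refine ⟨a, ha, haσ, ?_, ?_⟩ <;> rw [remaining] <;> linarith

/-- A job whose processing time has been reached has a completion time. -/
theorem exists_completesAt (hS : S.IsTwoThreshold I) (hε : 0 < ε)
    (ha : S.adm j = some (i, a)) (h : I.size i j ≤ S.processed i j τ) :
    ∃ σ ≤ τ, S.CompletesAt I j σ := by
  set A := {t | I.size i j ≤ S.processed i j t} with hA
  have hbdd : BddBelow A := ⟨a, fun t ht => by
    by_contra! hta
    have hz := hS.processed_eq_zero ha hta.le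
    have := hS.size_pos_of_adm hε ha
    simp only [hA, Set.mem_ofPred_eq] at ht
    linarith⟩
  have hclosed : IsClosed A := isClosed_le continuous_const (hS.continuous_processed ha)
  have hinf : sInf A ∈ A := hclosed.csInf_mem ⟨τ, h⟩ hbdd
  refine ⟨sInf A, csInf_le hbdd h, i, a, ha,
    le_antisymm (hS.processed_le_size hε ha _) hinf, fun s hs => ?_⟩
  by_contra! hge
  exact (csInf_le hbdd hge).not_gt hs

end Processing

/-! ### Active jobs and descendants. -/

section Chain

variable {i : Fin m} {j k : J} {a b τ : ℝ}

/-- Along the active jobs of a machine, the density increases with the admission time. -/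
theorem four_mul_density_le (hS : S.IsTwoThreshold I) (hε : 0 < ε)
    (hk : S.adm k = some (i, b)) (hact : j ∈ S.active I i b) :
    4 * I.density i j ≤ I.density i k := by
  obtain ⟨cur, hcur, hpass⟩ := hS.exists_passes hε hk
  cases cur with
  | none =>
    have : S.active I i b = ∅ := hcur
    rw [this] at hact
    exact hact.elim
  | some c =>
    have := ThroughputInstance.Interrupts.four_mul_density_le hε (hS.size_pos_of_adm hε hk) hpass
    linarith [hcur.2 j hact]

/-- Of two jobs that are active on a machine, the one that was admitted later is a descendant of the
other one. -/
theorem transGen_of_active [Finite J] (hS : S.IsTwoThreshold I) (hε : 0 < ε)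
    {par : J → Option J}
    (hpar : ∀ k i b, S.adm k = some (i, b) → I.IsDensest i (S.active I i b) (par k))
    (ha : S.adm j = some (i, a)) (hb : S.adm k = some (i, b)) (hact : j ∈ S.active I i b) :
    Relation.TransGen (fun k j => par k = some j) k j := by
  -- The induction runs from `k` through its ancestors, back to earlier admissions.
  have wf : WellFounded fun c k => S.admTime c < S.admTime k :=
    Finite.wellFounded_of_trans_of_irrefl (InvImage (· < ·) S.admTime)
  induction k using wf.induction generalizing b with
  | _ k ih =>
    have hden := hpar k i b hb
    cases hc : par k with
    | none =>
      rw [hc] at hden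
      have : S.active I i b = ∅ := hden
      rw [this] at hact
      exact hact.elim
    | some c =>
      rw [hc] at hden
      obtain ⟨hcact, hmax⟩ := hden
      obtain ⟨e, he, heb, -⟩ := id hcact
      rcases lt_trichotomy a e with hae | hae | hae
      · refine Relation.TransGen.head hc (ih c ?_ he (hS.mem_active_of_le ha hact hae heb.le))
        simpa only [admTime_eq he, admTime_eq hb] using heb
      · subst hae
        rw [hS.adm_injective hε ha he]
        exact Relation.TransGen.single hc
      -- If `c` were older than `j`, then `j` would be four times as dense, but `c` is a densest
      -- active job.
      · have h4 := hS.four_mul_density_le hε ha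
          (hS.mem_active_of_le he hcact hae (adm_eq_of_mem_active hact ha).2.le)
        have hpos := I.density_pos (hS.mem_candidates_of_adm hε ha).2.1
        linarith [hmax j hact, I.density_nonneg i c]

/-- While a job is active, its machine processes the job or one of its descendants. -/
theorem exists_proc_of_active [Finite J] (hS : S.IsTwoThreshold I) (hε : 0 < ε)
    {par : J → Option J}
    (hpar : ∀ k i b, S.adm k = some (i, b) → I.IsDensest i (S.active I i b) (par k))
    (ha : S.adm j = some (i, a)) (hact : j ∈ S.active I i τ ∪ {j | S.adm j = some (i, τ)}) :
    ∃ k, S.proc i τ = some k ∧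
      (k = j ∨ (Relation.TransGen (fun k j => par k = some j) k j ∧
        ∃ b, S.adm k = some (i, b))) := by
  have hden := hS.scheduling i τ
  cases hp : S.proc i τ with
  | none =>
    rw [hp] at hden
    have h0 : S.active I i τ ∪ {j | S.adm j = some (i, τ)} = ∅ := hden
    rw [h0] at hact
    exact hact.elim
  | some k =>
    rw [hp] at hden
    obtain ⟨hk, hmax⟩ := hden
    refine ⟨k, rfl, ?_⟩
    have hle := hmax j hact
    have hposj := I.density_pos (hS.mem_candidates_of_adm hε ha).2.1
    rcases hk with hk | hk
    · obtain ⟨b, hb, hbτ, -⟩ := id hk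
      rcases lt_trichotomy a b with hab | hab | hab
      · rcases hact with hact | hact
        · exact Or.inr ⟨hS.transGen_of_active hε hpar ha hb
            (hS.mem_active_of_le ha hact hab hbτ.le), b, hb⟩
        · have := hS.four_mul_density_le hε hact hk
          linarith [I.density_nonneg i k]
      · subst hab
        exact Or.inl (hS.adm_injective hε hb ha)
      · have haτ : a ≤ τ := by
          rcases hact with hact | hact
          · exact (adm_eq_of_mem_active hact ha).2.le
          · simp only [Set.mem_ofPred_eq] at hact
            rw [ha] at hact
            simp only [Option.some.injEq, Prod.mk.injEq, true_and] at hact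
            exact hact.le
        have := hS.four_mul_density_le hε ha (hS.mem_active_of_le hb hk hab haτ)
        linarith [I.density_nonneg i k]
    · rcases hact with hact | hact
      · exact Or.inr ⟨hS.transGen_of_active hε hpar ha hk hact, τ, hk⟩
      · exact Or.inl (hS.adm_injective hε hk hact)

open Classical in
/-- The descendants of a job that is not completed by its deadline have a total processing time of
at least the time for which the job can be interrupted. -/
theorem mul_size_le_sum_descendants [Fintype J] (hS : S.IsTwoThreshold I) (hε : 0 < ε)
    {par : J → Option J}
    (hpar : ∀ k i b, S.adm k = some (i, b) → I.IsDensest i (S.active I i b) (par k))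
    (ha : S.adm j = some (i, a)) (hj : ¬ ∃ τ ≤ I.d j, S.CompletesAt I j τ) :
    I.slackParam / 2 * I.size i j ≤
      ∑ k with Relation.TransGen (fun k j => par k = some j) k j, I.size i k := by
  have hpos := hS.size_pos_of_adm hε ha
  have hδ := I.slackParam_pos hε
  have hδp : 0 < I.slackParam / 2 * I.size i j := by positivity
  set e := a + (1 + I.slackParam / 2) * I.size i j with he
  have hae : a ≤ e := by linarith
  have hrem : S.processed i j e < I.size i j := by
    by_contra! h
    obtain ⟨σ, hσ, hc⟩ := hS.exists_completesAt hε ha h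
    exact hj ⟨σ, hσ.trans (hS.add_mul_size_le_deadline hε ha), hc⟩
  -- At `t` the job has waited exactly δ·p_j since its admission. The bound in `active` is then an
  -- equality, so the job is still active.
  obtain ⟨t, ⟨hat, hte⟩, ht⟩ : ∃ t ∈ Set.Icc a e,
      t - a - S.processed i j t = I.slackParam / 2 * I.size i j := by
    have hcont : Continuous fun t => t - a - S.processed i j t :=
      (continuous_id.sub continuous_const).sub (hS.continuous_processed ha)
    refine intermediate_value_Icc hae hcont.continuousOn ⟨?_, ?_⟩
    · have := hS.processed_eq_zero ha le_rfl
      linarith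
    · linarith
  have hlt : a < t := by
    rcases hat.lt_or_eq with h | h
    · exact h
    · have := hS.processed_eq_zero ha h.ge
      linarith
  have hact : j ∈ S.active I i t := by
    have := hS.processed_mono ha hte
    refine ⟨a, ha, hlt, ?_, ?_⟩ <;> rw [remaining] <;> linarith
  set D := Finset.univ.filter fun k => Relation.TransGen (fun k j => par k = some j) k j
  -- The bound of processed time by size is available only for jobs admitted to `i`.
  set E := D.filter fun k => ∃ b, S.adm k = some (i, b)
  have hcover : Set.Ico a t ⊆ {s | s < t ∧ S.proc i s = some j} ∪
      ⋃ k ∈ E, {s | s < t ∧ S.proc i s = some k} := by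
    rintro s ⟨has, hst⟩
    have hpres : j ∈ S.active I i s ∪ {j | S.adm j = some (i, s)} := by
      rcases has.lt_or_eq with h | h
      · exact Or.inl (hS.mem_active_of_le ha hact h hst.le)
      · exact Or.inr (h ▸ ha)
    obtain ⟨k, hk, rfl | ⟨hkj, hb⟩⟩ := hS.exists_proc_of_active hε hpar ha hpres
    · exact Or.inl ⟨hst, hk⟩
    · refine Or.inr (Set.mem_biUnion (x := k) ?_ ⟨hst, hk⟩)
      simp [E, D, hkj, hb]
  have hEfin : volume (⋃ k ∈ E, {s | s < t ∧ S.proc i s = some k}) ≠ ⊤ := by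
    refine (measure_biUnion_lt_top E.finite_toSet fun k hk => ?_).ne
    obtain ⟨b, hb⟩ := (Finset.mem_filter.1 hk).2
    exact (hS.volume_proc_ne_top hb t).lt_top
  have h1 := measureReal_mono hcover (measure_union_ne_top (hS.volume_proc_ne_top ha t) hEfin)
  rw [Real.volume_real_Ico_of_le hat] at h1
  have h2 := measureReal_union_le (μ := volume) {s | s < t ∧ S.proc i s = some j}
    (⋃ k ∈ E, {s | s < t ∧ S.proc i s = some k})
  have h3 := measureReal_biUnion_finset_le (μ := volume) E
    fun k => {s | s < t ∧ S.proc i s = some k}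
  have h4 : ∑ k ∈ E, volume.real {s | s < t ∧ S.proc i s = some k} ≤ ∑ k ∈ E, I.size i k :=
    Finset.sum_le_sum fun k hk => by
      obtain ⟨b, hb⟩ := (Finset.mem_filter.1 hk).2
      exact hS.processed_le_size hε hb t
  have h5 : ∑ k ∈ E, I.size i k ≤ ∑ k ∈ D, I.size i k :=
    Finset.sum_le_sum_of_subset_of_nonneg (Finset.filter_subset _ _)
      fun k _ _ => I.size_nonneg i k
  rw [processed] at ht
  linarith

end Chain

end IsTwoThreshold

end OnlineSchedule

/-! ### The interruption forest of an execution. -/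

theorem theorem3 {m : ℕ} {J : Type*} [Fintype J] {ε : ℝ} (hε : 0 < ε)
    (I : ThroughputInstance m J ε) (S : OnlineSchedule m J) (hS : S.IsTwoThreshold I) :
    ∑ j ∈ S.finishedJobs I, I.w j ≥ 1 / 2 * ∑ j ∈ S.admittedJobs, I.w j := by
  classical
  obtain ⟨par, hnone, hpar⟩ : ∃ par : J → Option J, (∀ k, S.adm k = none → par k = none) ∧
      ∀ k i b, S.adm k = some (i, b) →
        I.IsDensest i (S.active I i b) (par k) ∧ I.Passes i (par k) k := by
    have : ∀ k, ∃ o : Option J, (S.adm k = none → o = none) ∧ ∀ i b, S.adm k = some (i, b) →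
        I.IsDensest i (S.active I i b) o ∧ I.Passes i o k := fun k => by
      cases hk : S.adm k with
      | none => exact ⟨none, fun _ => rfl, fun i b h => by simp at h⟩
      | some x =>
        obtain ⟨i, b⟩ := x
        obtain ⟨o, ho⟩ := hS.exists_passes hε hk
        refine ⟨o, fun h => by simp at h, fun i' b' h => ?_⟩
        simp only [Option.some.injEq, Prod.mk.injEq] at h
        obtain ⟨rfl, rfl⟩ := h
        exact ho
    choose par h1 h2 using this
    exact ⟨par, h1, h2⟩
  have hchild : ∀ k j, par k = some j → ∃ i a b, S.adm j = some (i, a) ∧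
      S.adm k = some (i, b) ∧ a < b ∧ j ∈ S.active I i b ∧ I.Interrupts i j k := by
    intro k j hkj
    cases hk : S.adm k with
    | none => simp [hnone k hk] at hkj
    | some x =>
      obtain ⟨i, b⟩ := x
      obtain ⟨hden, hpass⟩ := hpar k i b hk
      rw [hkj] at hden hpass
      obtain ⟨a, ha, hab, -⟩ := id hden.1
      exact ⟨i, a, b, ha, rfl, hab, hden.1, hpass⟩
  -- Children are admitted strictly later than their parents, and there are finitely many jobs.
  have wf : WellFounded fun k j => par k = some j := by
    refine Subrelation.wf (r := InvImage (· > ·) S.admTime) (fun {k j} hkj => ?_)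
      (Finite.wellFounded_of_trans_of_irrefl _)
    obtain ⟨i, a, b, ha, hb, hab, -⟩ := hchild k j hkj
    simpa only [InvImage, OnlineSchedule.admTime_eq ha, OnlineSchedule.admTime_eq hb] using hab
  have hdesc : ∀ {k j i a}, Relation.TransGen (fun k j => par k = some j) k j →
      S.adm j = some (i, a) → ∃ b, S.adm k = some (i, b) := by
    intro k j i a h ha
    induction h using Relation.TransGen.head_induction_on with
    | single h =>
      obtain ⟨i', a', b, ha', hb, -⟩ := hchild _ _ h
      rw [ha] at ha'
      simp only [Option.some.injEq, Prod.mk.injEq] at ha'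
      exact ⟨b, ha'.1 ▸ hb⟩
    | head h _ ih =>
      obtain ⟨c, hc⟩ := ih
      obtain ⟨i', a', b, ha', hb, -⟩ := hchild _ _ h
      rw [hc] at ha'
      simp only [Option.some.injEq, Prod.mk.injEq] at ha'
      exact ⟨b, ha'.1 ▸ hb⟩
  -- Jobs never admitted become isolated vertices of weight 0 and dummy size 1. They are counted as
  -- finished below, so nothing about descendants is required of them.
  let p : J → ℝ := fun j => (S.adm j).elim 1 fun x => I.size x.1 j
  let w : J → ℝ := fun j => (S.adm j).elim 0 fun _ => I.w j
  have p_eq : ∀ {j i a}, S.adm j = some (i, a) → p j = I.size i j := fun h => by simp [p, h]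
  have w_eq : ∀ {j i a}, S.adm j = some (i, a) → w j = I.w j := fun h => by simp [w, h]
  have hmain := sum_le_two_mul_sum_of_forest wf (w := w) (p := p) (δ := I.slackParam / 2)
    (fun j => S.adm j = none ∨ ∃ τ ≤ I.d j, S.CompletesAt I j τ)
    (half_pos (I.slackParam_pos hε)) ?_ ?_ ?_ ?_ ?_
  · have h1 : ∑ j ∈ S.admittedJobs, I.w j = ∑ j, w j := by
      rw [OnlineSchedule.admittedJobs, Finset.sum_filter]
      refine Finset.sum_congr rfl fun j _ => ?_
      cases hj : S.adm j with
      | none => simp [w, hj]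
      | some x => simp [w, hj, show ∃ i a, x = (i, a) from ⟨x.1, x.2, rfl⟩]
    have h2 : ∑ j ∈ S.finishedJobs I, I.w j =
        ∑ j with S.adm j = none ∨ ∃ τ ≤ I.d j, S.CompletesAt I j τ, w j := by
      rw [OnlineSchedule.finishedJobs, Finset.sum_filter, Finset.sum_filter]
      refine Finset.sum_congr rfl fun j _ => ?_
      cases hj : S.adm j with
      | none =>
        have : ¬ ∃ τ ≤ I.d j, S.CompletesAt I j τ := by
          rintro ⟨τ, -, i, a, h, -⟩
          simp [hj] at h
        simp [w, hj, this]
      | some x => simp [w, hj]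
    rw [h1, h2]
    linarith
  · intro j
    cases hj : S.adm j with
    | none => simp [w, hj]
    | some x => simpa [w, hj] using (I.w_pos j).le
  · intro j
    cases hj : S.adm j with
    | none => simp [p, hj]
    | some x => simpa [p, hj] using hS.size_pos_of_adm hε (show S.adm j = some (x.1, x.2) from hj)
  · intro k j hkj
    obtain ⟨i, a, b, ha, hb, -, hact, -⟩ := hchild k j hkj
    have h := hS.four_mul_density_le hε hb hact
    rw [ThroughputInstance.density, ThroughputInstance.density, ← mul_div_assoc,
      div_le_div_iff₀ (hS.size_pos_of_adm hε ha) (hS.size_pos_of_adm hε hb)] at h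
    rwa [p_eq ha, p_eq hb, w_eq ha, w_eq hb]
  · intro k j hkj
    obtain ⟨i, a, b, ha, hb, -, -, hint⟩ := hchild k j hkj
    rw [p_eq ha, p_eq hb, w_eq ha, w_eq hb]
    exact hint.mul_size_le_or hε (hS.size_pos_of_adm hε ha) (hS.size_pos_of_adm hε hb)
  · intro j hj
    push Not at hj
    obtain ⟨⟨i, a⟩, ha⟩ := Option.ne_none_iff_exists'.1 hj.1
    have h := hS.mul_size_le_sum_descendants hε (fun k i b hk => (hpar k i b hk).1) ha
      (by push Not; exact hj.2)
    rw [p_eq ha]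
    refine h.trans (Finset.sum_le_sum fun k hk => ?_)
    obtain ⟨b, hb⟩ := hdesc (Finset.mem_filter.1 hk).2 ha
    exact (p_eq hb).ge
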